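/- Let $n\ge 1$ and let $G$ be an irreducible, essential (finite, real) reflection group acting on $V=\mathbb{R}^n$ by orthogonal transformations; that is, $G$ is a finite group of orthogonal transformations generated by reflections, it fixes no nonzero vector, and it is not the product of two nontrivial reflection groups. For a reflection group $G'$ on $V$ (the trivial group included) let $d_n(G')$ be the largest degree of a basic invariant of $G'$, i.e. the largest degree among homogeneous, algebraically independent polynomials $\pi_1,\dots,\pi_n\in\mathbb{R}[V]$ that generate $\mathbb{R}[V]^{G'}$. Let $\mathcal{H}_i(G)$ be the set of points of $V$ that are contained in some $i$-dimensional intersection of reflection hyperplanes of $G$ (so $\mathcal{H}_n(G)=V$). A point is called $G'$-general if it lies on no reflection hyperplane of $G'$. For an integer $d\ge 0$ let $\ell(d)$ be the smallest integer $\ell\ge 0$ such that for every $p\in V\setminus\mathcal{H}_{\ell}(G)$ there is a reflection subgroup $G'\subseteq G$ such that $p$ is $G'$-general and $2d_n(G')>d$. Let $\Delta$ be a simple system in the root system formed by the unit normals of the reflection hyperplanes of $G$, let $W_I$ denote the standard parabolic subgroup generated by the reflections $s_\alpha$, $\alpha\in I$, and put $$ p(d) \;=\; \min\{\, |I|-1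 \;:\; \emptyset\ne I\subseteq\Delta,\ 2d_n(W_I)>d \,\}, $$ with $p(d)=\infty$ if there is no such $I$. Then $\ell(d)\le p(d)$ for every integer $d\ge 0$. -/

import Mathlib

namespace ReflGrp

/-- The Euclidean space `ℝⁿ`. -/
abbrev E (n : ℕ) : Type := EuclideanSpace ℝ (Fin n)

/-- The group `O(ℝⁿ)` of orthogonal transformations. -/
abbrev O (n : ℕ) : Type := E n ≃ₗᵢ[ℝ] E n

variable {n : ℕ}

/-- The orthogonal reflection `s_α` in the hyperplane `α^⊥` (used only for `α ≠ 0`). -/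
noncomputable def refl (α : E n) : O n := (Submodule.span ℝ {α})ᗮ.reflection

/-- `g` is a reflection: it is the orthogonal reflection in some linear hyperplane. -/
def IsReflection (g : O n) : Prop := ∃ α : E n, α ≠ 0 ∧ g = refl α

/-- A reflection group: a finite group of orthogonal transformations that is generated by
reflections. The trivial group is one (generated by the empty set). -/
def IsReflectionGroup (G : Subgroup (O n)) : Prop :=
  Finite G ∧ Subgroup.closure {g : O n | g ∈ G ∧ IsReflection g} = G

/-- `G` is essential: it fixes no nonzero vector. -/
def IsEssential (G : Subgroup (O n)) : Prop :=
  ∀ v : E n, (∀ g ∈ G, g v = v) → v = 0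

/-- `G` is irreducible: it is not the (internal direct) product of two nontrivial
reflection groups. -/
def IsIrreducible (G : Subgroup (O n)) : Prop :=
  ¬ ∃ G₁ G₂ : Subgroup (O n),
      IsReflectionGroup G₁ ∧ IsReflectionGroup G₂ ∧ G₁ ≠ ⊥ ∧ G₂ ≠ ⊥ ∧
      (∀ g ∈ G₁, ∀ h ∈ G₂, g * h = h * g) ∧ G₁ ⊓ G₂ = ⊥ ∧ G₁ ⊔ G₂ = G

/-- The roots of `G`: the unit normal vectors of the reflection hyperplanes of `G`. -/
def roots (G : Subgroup (O n)) : Set (E n) := {α | ‖α‖ = 1 ∧ refl α ∈ G}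

/-- The reflection arrangement of `G`: the fixed hyperplanes of the reflections in `G`. -/
def arrangement (G : Subgroup (O n)) : Set (Submodule ℝ (E n)) :=
  {H | ∃ α : E n, α ≠ 0 ∧ refl α ∈ G ∧ H = (Submodule.span ℝ {α})ᗮ}

/-- The flats of the arrangement: all intersections of reflection hyperplanes (the empty
intersection being the whole space). -/
def flats (G : Subgroup (O n)) : Set (Submodule ℝ (E n)) :=
  {F | ∃ S : Set (Submodule ℝ (E n)), S ⊆ arrangement G ∧ F = sInf S}

/-- The stratum `ℋ_i(G)`: the points contained in a flat of dimension `i`. -/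
def stratum (G : Subgroup (O n)) (i : ℕ) : Set (E n) :=
  {p | ∃ F ∈ flats G, Module.finrank ℝ F = i ∧ p ∈ F}

/-- `p` is `G`-general: it lies on no reflection hyperplane of `G`. -/
def IsGeneral (G : Subgroup (O n)) (p : E n) : Prop := ∀ H ∈ arrangement G, p ∉ H

/-- The ring of invariants `ℝ[V]^G`. (A real polynomial is determined by its values, so
invariance can be tested on points.) -/
noncomputable def invariants (G : Subgroup (O n)) : Subalgebra ℝ (MvPolynomial (Fin n) ℝ) where
  carrier := {f | ∀ g ∈ G, ∀ x : E n,
    MvPolynomial.eval (fun i => (g x) i) f = MvPolynomial.eval (fun i => x i) f}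
  mul_mem' := by
    intro a b ha hb g hg x
    rw [map_mul, map_mul, ha g hg x, hb g hg x]
  add_mem' := by
    intro a b ha hb g hg x
    rw [map_add, map_add, ha g hg x, hb g hg x]
  algebraMap_mem' := by
    intro r g _ x
    simp [MvPolynomial.algebraMap_eq]

/-- `π₁, …, π_n` is a set of basic invariants of `G`: algebraically independent homogeneous
polynomials that generate the ring of invariants. -/
structure IsBasicInvariants (G : Subgroup (O n)) (π : Fin n → MvPolynomial (Fin n) ℝ) :
    Prop where
  homogeneous : ∀ i, (π i).IsHomogeneous (π i).totalDegree
  algebraicIndependent : AlgebraicIndependent ℝ π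
  generate : Algebra.adjoin ℝ (Set.range π) = invariants G

/-- `d_n(G)`, the largest degree of a basic invariant of `G` (as a group acting on all of `ℝⁿ`).
The degrees do not depend on the choice of the basic invariants, so that the supremum is over
a nonempty finite set whenever `G` is a reflection group on `ℝⁿ` and `n ≥ 1`. -/
noncomputable def topDegree (G : Subgroup (O n)) : ℕ :=
  sSup {e | ∃ π : Fin n → MvPolynomial (Fin n) ℝ,
    IsBasicInvariants G π ∧ ∃ i, e = (π i).totalDegree}

/-- `ℓ(d)`: the smallest `ℓ ≥ 0` such that for every point `p` outside `ℋ_ℓ(G)` there is a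
reflection subgroup `G' ⊆ G` such that `p` is `G'`-general and `2 d_n(G') > d`.
(The set is nonempty: it contains `n`, because `ℋ_n(G)` is the whole space.) -/
noncomputable def strataNumber (G : Subgroup (O n)) (d : ℕ) : ℕ :=
  sInf {l : ℕ | ∀ p : E n, p ∉ stratum G l →
    ∃ G' : Subgroup (O n), G' ≤ G ∧ IsReflectionGroup G' ∧ IsGeneral G' p ∧
      d < 2 * topDegree G'}

/-- `Δ` is a simple system for `G`: a linearly independent set of roots such that every root
is a linear combination of `Δ` with all coefficients nonnegative or all nonpositive. -/
structure IsSimpleSystem (G : Subgroup (O n)) (Δ : Finset (E n)) : Prop where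
  subset_roots : ∀ α ∈ Δ, α ∈ roots G
  linearIndependent : LinearIndependent ℝ (fun α : Δ => (α : E n))
  combination : ∀ β ∈ roots G, ∃ c : E n → ℝ,
    β = ∑ α ∈ Δ, c α • α ∧ ((∀ α ∈ Δ, 0 ≤ c α) ∨ (∀ α ∈ Δ, c α ≤ 0))

/-- The standard parabolic subgroup `W_I`, generated by the reflections `s_α`, `α ∈ I`. -/
noncomputable def parabolic (I : Finset (E n)) : Subgroup (O n) :=
  Subgroup.closure {g : O n | ∃ α ∈ I, g = refl α}

/-- `p(d) = min {|I| - 1 : ∅ ≠ I ⊆ Δ, 2 d_n(W_I) > d}`, with value `⊤` if there is no such `I`.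
Since `I` is nonempty, the subtraction is not truncated. -/
noncomputable def parabolicNumber (Δ : Finset (E n)) (d : ℕ) : ℕ∞ :=
  sInf {m : ℕ∞ | ∃ I : Finset (E n), I ⊆ Δ ∧ I.Nonempty ∧ d < 2 * topDegree (parabolic I) ∧
    m = ((I.card - 1 : ℕ) : ℕ∞)}

end ReflGrp

/-!
Let `W` be a reflection subgroup of `G` of rank `r` with `2 d_n(W) > d`, and let `p` lie outside
`ℋ_{r-1}(G)`, so that the smallest flat through `p` has dimension at least `r`. It is enough to find
`g ∈ G` such that `g p` is `W`-general: then `p` is general for `g⁻¹ W g`, and conjugation does not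
change the degrees of basic invariants. Choose `g` such that as few roots of `W` as possible are
orthogonal to `q = g p`. If some root `z` of `W` is orthogonal to `q`, then `z` is orthogonal to the
smallest flat `F` through `q`, and since `dim F ≥ r`, a dimension count gives a nonzero `y ∈ F`
orthogonal to all roots of `W`. As `G` is irreducible and essential, it has a root `β` that is
orthogonal neither to `y` nor to `z`. The roots of `W` orthogonal to `s_β q` are then roots
orthogonal to both `q` and `β`, so `z` is no longer among them, contradicting minimality.
-/

namespace ReflGrp

open scoped InnerProductSpace Pointwise

section LinearAlgebra

theorem exists_norm_eq_one_span_singleton_eq (𝕜 : Type*) {V : Type*} [RCLike 𝕜]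
    [NormedAddCommGroup V] [NormedSpace 𝕜 V] {v : V} (hv : v ≠ 0) :
    ∃ u : V, ‖u‖ = 1 ∧ Submodule.span 𝕜 {u} = Submodule.span 𝕜 {v} :=
  ⟨(‖v‖⁻¹ : 𝕜) • v, norm_smul_inv_norm hv, Submodule.span_singleton_smul_eq
    (inv_ne_zero (RCLike.ofReal_ne_zero.2 (norm_ne_zero_iff.2 hv))).isUnit v⟩

theorem exists_subset_finrank_sInf_eq {K V : Type*} [DivisionRing K] [AddCommGroup V] [Module K V]
    [FiniteDimensional K V] {𝓗 : Set (Submodule K V)}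
    (h𝓗 : ∀ H ∈ 𝓗, Module.finrank K V ≤ Module.finrank K H + 1) {l : ℕ}
    (hl : Module.finrank K ↥(sInf 𝓗) ≤ l) (hlV : l ≤ Module.finrank K V) :
    ∃ S ⊆ 𝓗, Module.finrank K ↥(sInf S) = l := by
  refine Nat.decreasingInduction' (P := fun k => ∃ S ⊆ 𝓗, Module.finrank K ↥(sInf S) = k)
    ?_ hlV ⟨∅, Set.empty_subset _, by rw [sInf_empty, finrank_top]⟩
  rintro k - hlk ⟨S, hS, hSk⟩
  obtain ⟨H, hH, hSH⟩ : ∃ H ∈ 𝓗, ¬ sInf S ≤ H := by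
    by_contra! hle
    have := Submodule.finrank_mono (le_sInf hle)
    omega
  refine ⟨insert H S, Set.insert_subset hH hS, ?_⟩
  rw [sInf_insert]
  have hlt : Module.finrank K ↥(H ⊓ sInf S) < Module.finrank K ↥(sInf S) :=
    Submodule.finrank_lt_finrank_of_lt (inf_lt_right.2 hSH)
  have hdim := Submodule.finrank_sup_add_finrank_inf_eq H (sInf S)
  have hsup := Submodule.finrank_le (H ⊔ sInf S)
  have hcodim := h𝓗 H hH
  omega

variable {𝕜 V : Type*} [RCLike 𝕜] [NormedAddCommGroup V] [InnerProductSpace 𝕜 V]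

theorem finrank_le_finrank_orthogonal_span_singleton_add_one [FiniteDimensional 𝕜 V] (v : V) :
    Module.finrank 𝕜 V ≤ Module.finrank 𝕜 (𝕜 ∙ v)ᗮ + 1 := by
  have hline := finrank_span_le_card (R := 𝕜) {v}
  rw [Set.toFinset_singleton, Finset.card_singleton] at hline
  have := (𝕜 ∙ v).finrank_add_finrank_orthogonal
  omega

theorem finrank_add_finrank_inf_orthogonal [FiniteDimensional 𝕜 V] (U F : Submodule 𝕜 V) :
    Module.finrank 𝕜 F + Module.finrank 𝕜 ↥(U ⊓ Fᗮ) =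
      Module.finrank 𝕜 U + Module.finrank 𝕜 ↥(F ⊓ Uᗮ) := by
  have hsupinf := Submodule.finrank_sup_add_finrank_inf_eq U Fᗮ
  have hF := F.finrank_add_finrank_orthogonal
  have hUF := (U ⊔ Fᗮ).finrank_add_finrank_orthogonal
  rw [← Submodule.inf_orthogonal, Submodule.orthogonal_orthogonal, inf_comm Uᗮ] at hUF
  omega

theorem exists_mem_orthogonal_ne_zero [FiniteDimensional 𝕜 V] {U F : Submodule 𝕜 V}
    (hUF : Module.finrank 𝕜 U ≤ Module.finrank 𝕜 F) {z : V} (hz : z ≠ 0) (hzU : z ∈ U)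
    (hzF : z ∈ Fᗮ) : ∃ y ∈ F, y ∈ Uᗮ ∧ y ≠ 0 := by
  have hpos : 0 < Module.finrank 𝕜 ↥(U ⊓ Fᗮ) :=
    Module.finrank_pos_iff_exists_ne_zero.2 ⟨⟨z, hzU, hzF⟩, fun h => hz (congrArg Subtype.val h)⟩
  have hne : F ⊓ Uᗮ ≠ ⊥ := by
    rw [← Submodule.one_le_finrank_iff]
    have := finrank_add_finrank_inf_orthogonal U F
    omega
  obtain ⟨y, ⟨hyF, hyU⟩, hy⟩ := Submodule.exists_mem_ne_zero_of_ne_bot hne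
  exact ⟨y, hyF, hyU, hy⟩

end LinearAlgebra

variable {n : ℕ}

section Reflections

variable {α β x : E n}

theorem refl_apply_eq_self_iff : refl α x = x ↔ ⟪α, x⟫_ℝ = 0 :=
  (Submodule.reflection_eq_self_iff x).trans Submodule.mem_orthogonal_singleton_iff_inner_right

theorem refl_apply_of_norm_eq_one (hα : ‖α‖ = 1) (x : E n) :
    refl α x = x - (2 * ⟪α, x⟫_ℝ) • α := by
  rw [refl, Submodule.reflection_orthogonal_apply, Submodule.reflection_singleton_apply, hα]
  module

theorem inner_refl_left (α x y : E n) : ⟪refl α x, y⟫_ℝ = ⟪x, refl α y⟫_ℝ := by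
  rw [LinearIsometryEquiv.inner_map_eq_flip, refl, Submodule.reflection_symm]

theorem refl_ne_one (hα : α ≠ 0) : refl α ≠ 1 := fun h =>
  hα <| inner_self_eq_zero.1 <| refl_apply_eq_self_iff.1 <| by
    rw [h, LinearIsometryEquiv.coe_one, id]

theorem refl_map (g : O n) (α : E n) : refl (g α) = g * refl α * g⁻¹ := by
  have hmap : (ℝ ∙ g α)ᗮ = (ℝ ∙ α)ᗮ.map (g.toLinearEquiv : E n →ₗ[ℝ] E n) := by
    rw [Submodule.map_orthogonal_equiv, Submodule.map_span, Set.image_singleton]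
    rfl
  simp only [refl, hmap, Submodule.reflection_map]
  rfl

theorem commute_refl (h : ⟪α, β⟫_ℝ = 0) : Commute (refl α) (refl β) := by
  have hconj := refl_map (refl α) β
  rw [refl_apply_eq_self_iff.2 h, eq_mul_inv_iff_mul_eq] at hconj
  exact hconj.symm

end Reflections

section Roots

variable {G W : Subgroup (O n)} {g : O n} {α p : E n} {S : Set (E n)}

theorem ne_zero_of_mem_roots (hα : α ∈ roots G) : α ≠ 0 :=
  norm_ne_zero_iff.1 (hα.1 ▸ one_ne_zero)

theorem map_mem_roots (hg : g ∈ G) (hα : α ∈ roots G) : g α ∈ roots G :=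
  ⟨(g.norm_map α).trans hα.1, refl_map g α ▸ G.mul_mem (G.mul_mem hg hα.2) (G.inv_mem hg)⟩

theorem exists_mem_roots_span_eq (hα : α ≠ 0) (hαG : refl α ∈ G) :
    ∃ β ∈ roots G, Submodule.span ℝ {β} = Submodule.span ℝ {α} := by
  obtain ⟨β, hβ, hspan⟩ := exists_norm_eq_one_span_singleton_eq ℝ hα
  exact ⟨β, ⟨hβ, by simpa only [refl, hspan] using hαG⟩, hspan⟩

theorem arrangement_eq_image_roots (G : Subgroup (O n)) :
    arrangement G = (fun α => (Submodule.span ℝ {α})ᗮ) '' roots G := by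
  ext H
  constructor
  · rintro ⟨α, hα, hαG, rfl⟩
    obtain ⟨β, hβ, hspan⟩ := exists_mem_roots_span_eq hα hαG
    exact ⟨β, hβ, congrArg _ hspan⟩
  · rintro ⟨α, hα, rfl⟩
    exact ⟨α, ne_zero_of_mem_roots hα, hα.2, rfl⟩

theorem isGeneral_iff : IsGeneral G p ↔ ∀ α ∈ roots G, ⟪α, p⟫_ℝ ≠ 0 := by
  simp only [IsGeneral, arrangement_eq_image_roots, Set.forall_mem_image,
    Submodule.mem_orthogonal_singleton_iff_inner_right, ne_eq]

/-- The group generated by the reflections `s_α`, `α ∈ S`. For finite `S` it is the group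
`parabolic S`; arbitrary sets are allowed so that `S` can be the set of all roots of a group. -/
noncomputable def reflClosure (S : Set (E n)) : Subgroup (O n) := Subgroup.closure (refl '' S)

theorem parabolic_eq_reflClosure (I : Finset (E n)) :
    parabolic I = reflClosure (I : Set (E n)) := by
  simp only [parabolic, reflClosure, Set.image, Finset.mem_coe, eq_comm]

theorem reflClosure_le (hS : S ⊆ roots G) : reflClosure S ≤ G :=
  (Subgroup.closure_le G).2 (Set.image_subset_iff.2 fun _ hα => (hS hα).2)

theorem mem_roots_reflClosure (hS : S ⊆ roots G) (hα : α ∈ S) : α ∈ roots (reflClosure S) :=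
  ⟨(hS hα).1, Subgroup.subset_closure (Set.mem_image_of_mem refl hα)⟩

theorem reflClosure_ne_bot (hS : S ⊆ roots G) (hne : S.Nonempty) : reflClosure S ≠ ⊥ := by
  obtain ⟨α, hα⟩ := hne
  exact fun h => refl_ne_one (ne_zero_of_mem_roots (hS hα))
    ((Subgroup.eq_bot_iff_forall _).1 h _ (mem_roots_reflClosure hS hα).2)

theorem isReflectionGroup_iff : IsReflectionGroup G ↔ Finite G ∧ reflClosure (roots G) = G := by
  have himage : {g : O n | g ∈ G ∧ IsReflection g} = refl '' roots G := by
    ext g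
    constructor
    · rintro ⟨hg, α, hα, rfl⟩
      obtain ⟨β, hβ, hspan⟩ := exists_mem_roots_span_eq hα hg
      exact ⟨β, hβ, by simp only [refl, hspan]⟩
    · rintro ⟨α, hα, rfl⟩
      exact ⟨hα.2, α, ne_zero_of_mem_roots hα, rfl⟩
  rw [IsReflectionGroup, himage, reflClosure]

theorem isReflectionGroup_reflClosure [Finite G] (hS : S ⊆ roots G) :
    IsReflectionGroup (reflClosure S) :=
  isReflectionGroup_iff.2
    ⟨Finite.of_injective _ (Subgroup.inclusion_injective (reflClosure_le hS)),
      (reflClosure_le subset_rfl).antisymm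
        (Subgroup.closure_mono (Set.image_mono fun _ hα => mem_roots_reflClosure hS hα))⟩

theorem apply_eq_self_of_mem_reflClosure {v : E n} (hv : ∀ α ∈ S, ⟪α, v⟫_ℝ = 0)
    (hg : g ∈ reflClosure S) : g v = v := by
  induction hg using Subgroup.closure_induction with
  | mem _ h =>
    obtain ⟨α, hα, rfl⟩ := h
    exact refl_apply_eq_self_iff.2 (hv α hα)
  | one => rfl
  | mul g h _ _ hg hh => rw [LinearIsometryEquiv.coe_mul, Function.comp_apply, hh, hg]
  | inv g _ hg => exact g.symm_apply_eq.2 hg.symm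

theorem mem_span_of_mem_roots_reflClosure (hα : α ∈ roots (reflClosure S)) :
    α ∈ Submodule.span ℝ S := by
  rw [← (Submodule.span ℝ S).orthogonal_orthogonal, Submodule.mem_orthogonal']
  exact fun v hv => refl_apply_eq_self_iff.1 <|
    apply_eq_self_of_mem_reflClosure (fun β hβ => hv β (Submodule.subset_span hβ)) hα.2

/-- The rank of a reflection group: the dimension of the span of its roots. -/
noncomputable def rank (G : Subgroup (O n)) : ℕ := Module.finrank ℝ (Submodule.span ℝ (roots G))

theorem rank_le : rank G ≤ n :=
  (Submodule.finrank_le _).trans_eq finrank_euclideanSpace_fin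

theorem IsReflectionGroup.rank_pos (hG : IsReflectionGroup G) (hne : G ≠ ⊥) : 0 < rank G := by
  obtain ⟨α, hα⟩ : (roots G).Nonempty := by
    by_contra! hempty
    rw [← (isReflectionGroup_iff.1 hG).2, hempty, reflClosure, Set.image_empty,
      Subgroup.closure_empty] at hne
    exact hne rfl
  exact Module.finrank_pos_iff_exists_ne_zero.2
    ⟨⟨α, Submodule.subset_span hα⟩, fun h => ne_zero_of_mem_roots hα (congrArg Subtype.val h)⟩

theorem rank_parabolic_le_card (I : Finset (E n)) : rank (parabolic I) ≤ I.card := by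
  rw [parabolic_eq_reflClosure]
  have hspan : Submodule.span ℝ (roots (reflClosure (I : Set (E n)))) ≤ Submodule.span ℝ I :=
    Submodule.span_le.2 fun _ => mem_span_of_mem_roots_reflClosure
  exact (Submodule.finrank_mono hspan).trans (finrank_span_finset_le_card I)

end Roots

section Irreducible

variable {G : Subgroup (O n)}

theorem reflClosure_le_centralizer {S T : Set (E n)} (hST : ∀ α ∈ S, ∀ β ∈ T, ⟪α, β⟫_ℝ = 0) :
    reflClosure S ≤ Subgroup.centralizer (reflClosure T) := by
  rw [reflClosure, reflClosure, Subgroup.centralizer_closure, Subgroup.closure_le]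
  rintro _ ⟨α, hα, rfl⟩
  rw [SetLike.mem_coe, Subgroup.mem_centralizer_iff]
  rintro _ ⟨β, hβ, rfl⟩
  exact (commute_refl (hST α hα β hβ)).symm

theorem reflClosure_inf_reflClosure_eq_bot {M : Submodule ℝ (E n)} {S T : Set (E n)}
    (hS : S ⊆ M) (hT : T ⊆ Mᗮ) : reflClosure S ⊓ reflClosure T = ⊥ := by
  rw [Subgroup.eq_bot_iff_forall]
  rintro g ⟨hgS, hgT⟩
  ext1 x
  obtain ⟨a, ha, b, hb, rfl⟩ := M.exists_add_mem_mem_orthogonal x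
  have hga : g a = a := apply_eq_self_of_mem_reflClosure
    (fun β hβ => M.inner_left_of_mem_orthogonal ha (hT hβ)) hgT
  have hgb : g b = b := apply_eq_self_of_mem_reflClosure
    (fun α hα => M.inner_right_of_mem_orthogonal (hS hα) hb) hgS
  rw [map_add, hga, hgb, LinearIsometryEquiv.coe_one, id]

theorem IsEssential.eq_zero_of_inner_roots_eq_zero (hess : IsEssential G)
    (hG : IsReflectionGroup G) {v : E n} (hv : ∀ α ∈ roots G, ⟪α, v⟫_ℝ = 0) : v = 0 :=
  hess v fun g hg => apply_eq_self_of_mem_reflClosure hv <| by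
    rwa [(isReflectionGroup_iff.1 hG).2]

theorem IsIrreducible.roots_subset_or_subset_orthogonal (hirr : IsIrreducible G)
    (hG : IsReflectionGroup G) {M : Submodule ℝ (E n)}
    (hM : ∀ α ∈ roots G, α ∈ M ∨ α ∈ Mᗮ) : roots G ⊆ M ∨ roots G ⊆ Mᗮ := by
  obtain ⟨_, hgen⟩ := isReflectionGroup_iff.1 hG
  by_contra! ⟨hnotM, hnotPerp⟩
  have hunion : roots G ∩ M ∪ roots G ∩ Mᗮ = roots G := by
    rw [← Set.inter_union_distrib_left, Set.inter_eq_left]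
    exact hM
  have hneM : (roots G ∩ M).Nonempty := by
    obtain ⟨α, hα, hαPerp⟩ := Set.not_subset.1 hnotPerp
    exact ⟨α, hα, (hM α hα).resolve_right hαPerp⟩
  have hnePerp : (roots G ∩ Mᗮ).Nonempty := by
    obtain ⟨α, hα, hαM⟩ := Set.not_subset.1 hnotM
    exact ⟨α, hα, (hM α hα).resolve_left hαM⟩
  have hcomm := reflClosure_le_centralizer (S := roots G ∩ M) (T := roots G ∩ Mᗮ)
    fun α hα β hβ => M.inner_right_of_mem_orthogonal hα.2 hβ.2
  refine hirr ⟨reflClosure (roots G ∩ M), reflClosure (roots G ∩ Mᗮ),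
    isReflectionGroup_reflClosure Set.inter_subset_left,
    isReflectionGroup_reflClosure Set.inter_subset_left,
    reflClosure_ne_bot Set.inter_subset_left hneM,
    reflClosure_ne_bot Set.inter_subset_left hnePerp,
    fun g hg h hh => (Subgroup.mem_centralizer_iff.1 (hcomm hg) h hh).symm,
    reflClosure_inf_reflClosure_eq_bot Set.inter_subset_right Set.inter_subset_right, ?_⟩
  conv_rhs => rw [← hgen, ← hunion]
  simp only [reflClosure, Set.image_union, Subgroup.closure_union]

theorem mem_span_or_mem_orthogonal_of_mem_roots {γ : E n} (hγ : γ ∈ roots G) (y : E n) :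
    γ ∈ Submodule.span ℝ {β | β ∈ roots G ∧ ⟪β, y⟫_ℝ ≠ 0} ∨
      γ ∈ (Submodule.span ℝ {β | β ∈ roots G ∧ ⟪β, y⟫_ℝ ≠ 0})ᗮ := by
  set M := Submodule.span ℝ {β | β ∈ roots G ∧ ⟪β, y⟫_ℝ ≠ 0}
  rcases ne_or_eq ⟪γ, y⟫_ℝ 0 with hγy | hγy
  · exact Or.inl (Submodule.subset_span ⟨hγ, hγy⟩)
  by_cases horth : ∀ β ∈ roots G, ⟪β, y⟫_ℝ ≠ 0 → ⟪β, γ⟫_ℝ = 0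
  · right
    rw [← Submodule.span_singleton_le_iff_mem, ← Submodule.isOrtho_iff_le, Submodule.isOrtho_comm,
      Submodule.isOrtho_span]
    rintro β ⟨hβ, hβy⟩ _ rfl
    exact horth β hβ hβy
  · left
    push Not at horth
    obtain ⟨β, hβ, hβy, hβγ⟩ := horth
    have hβM : β ∈ M := Submodule.subset_span ⟨hβ, hβy⟩
    have hreflM : refl β γ ∈ M := by
      refine Submodule.subset_span ⟨map_mem_roots hβ.2 hγ, ?_⟩
      rw [refl_apply_of_norm_eq_one hβ.1, inner_sub_left, real_inner_smul_left, hγy, zero_sub,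
        neg_ne_zero]
      exact mul_ne_zero (mul_ne_zero two_ne_zero hβγ) hβy
    rw [refl_apply_of_norm_eq_one hβ.1] at hreflM
    exact (M.sub_mem_iff_left (M.smul_mem _ hβM)).1 hreflM

theorem IsIrreducible.span_roots_inner_ne_zero_eq_top (hirr : IsIrreducible G)
    (hG : IsReflectionGroup G) (hess : IsEssential G) {y : E n} (hy : y ≠ 0) :
    Submodule.span ℝ {β | β ∈ roots G ∧ ⟪β, y⟫_ℝ ≠ 0} = ⊤ := by
  set M := Submodule.span ℝ {β | β ∈ roots G ∧ ⟪β, y⟫_ℝ ≠ 0}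
  obtain ⟨β, hβ, hβy⟩ : ∃ β ∈ roots G, ⟪β, y⟫_ℝ ≠ 0 := by
    by_contra! h
    exact hy (hess.eq_zero_of_inner_roots_eq_zero hG h)
  have hrootsM : roots G ⊆ M := by
    refine (hirr.roots_subset_or_subset_orthogonal hG fun γ hγ =>
      mem_span_or_mem_orthogonal_of_mem_roots hγ y).resolve_right fun hperp => ?_
    have hβM : β ∈ M := Submodule.subset_span ⟨hβ, hβy⟩
    exact ne_zero_of_mem_roots hβ (M.inf_orthogonal_eq_bot.le ⟨hβM, hperp hβ⟩)
  rw [← Submodule.orthogonal_eq_bot_iff, Submodule.eq_bot_iff]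
  exact fun v hv => hess.eq_zero_of_inner_roots_eq_zero hG fun α hα => hv α (hrootsM hα)

theorem IsIrreducible.exists_root_inner_ne_zero (hirr : IsIrreducible G)
    (hG : IsReflectionGroup G) (hess : IsEssential G) {y z : E n} (hy : y ≠ 0) (hz : z ≠ 0) :
    ∃ β ∈ roots G, ⟪β, y⟫_ℝ ≠ 0 ∧ ⟪β, z⟫_ℝ ≠ 0 := by
  by_contra! horth
  have hle : Submodule.span ℝ {β | β ∈ roots G ∧ ⟪β, y⟫_ℝ ≠ 0} ≤ (ℝ ∙ z)ᗮ :=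
    Submodule.span_le.2 fun β hβ =>
      Submodule.mem_orthogonal_singleton_iff_inner_left.2 (horth β hβ.1 hβ.2)
  rw [hirr.span_roots_inner_ne_zero_eq_top hG hess hy] at hle
  exact hz (inner_self_eq_zero.1 (Submodule.mem_orthogonal_singleton_iff_inner_right.1
    (hle Submodule.mem_top)))

end Irreducible

section Flats

variable {G W : Subgroup (O n)} {g : O n} {p v : E n}

/-- The smallest flat of `G` that contains `p`. -/
noncomputable def minimalFlat (G : Subgroup (O n)) (p : E n) : Submodule ℝ (E n) :=
  sInf {H ∈ arrangement G | p ∈ H}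

theorem mem_minimalFlat_iff :
    v ∈ minimalFlat G p ↔ ∀ α ∈ roots G, ⟪α, p⟫_ℝ = 0 → ⟪α, v⟫_ℝ = 0 := by
  simp only [minimalFlat, Submodule.mem_sInf, Set.mem_ofPred_eq, and_imp,
    arrangement_eq_image_roots, Set.forall_mem_image,
    Submodule.mem_orthogonal_singleton_iff_inner_right]

theorem finrank_minimalFlat_le_map (hg : g ∈ G) :
    Module.finrank ℝ (minimalFlat G p) ≤ Module.finrank ℝ (minimalFlat G (g p)) := by
  have hle : (minimalFlat G p).map (g.toLinearEquiv : E n →ₗ[ℝ] E n) ≤ minimalFlat G (g p) := by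
    rintro _ ⟨v, hv, rfl⟩
    refine mem_minimalFlat_iff.2 fun α hα hαp => ?_
    have hflip : ∀ x, ⟪g⁻¹ α, x⟫_ℝ = ⟪α, g x⟫_ℝ := (g⁻¹).inner_map_eq_flip α
    exact (hflip v).symm.trans <|
      mem_minimalFlat_iff.1 hv _ (map_mem_roots (G.inv_mem hg) hα) ((hflip p).trans hαp)
  exact (LinearEquiv.finrank_map_eq g.toLinearEquiv _).ge.trans (Submodule.finrank_mono hle)

theorem lt_finrank_minimalFlat {l : ℕ} (hl : l ≤ n) (hp : p ∉ stratum G l) :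
    l < Module.finrank ℝ (minimalFlat G p) := by
  by_contra! hle
  obtain ⟨S, hS, hSl⟩ : ∃ S ⊆ {H ∈ arrangement G | p ∈ H}, Module.finrank ℝ ↥(sInf S) = l := by
    refine exists_subset_finrank_sInf_eq ?_ hle (hl.trans_eq finrank_euclideanSpace_fin.symm)
    rintro _ ⟨⟨α, -, -, rfl⟩, -⟩
    exact finrank_le_finrank_orthogonal_span_singleton_add_one α
  exact hp ⟨sInf S, ⟨S, fun H hH => (hS hH).1, rfl⟩, hSl,
    Submodule.mem_sInf.2 fun H hH => (hS hH).2⟩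

theorem inner_eq_zero_of_inner_refl_eq_zero {β γ q y : E n} (hβ : β ∈ roots G) (hγ : γ ∈ roots G)
    (hy : y ∈ minimalFlat G q) (hβy : ⟪β, y⟫_ℝ ≠ 0) (hγy : ⟪γ, y⟫_ℝ = 0)
    (hγq : ⟪γ, refl β q⟫_ℝ = 0) : ⟪β, γ⟫_ℝ = 0 ∧ ⟪γ, q⟫_ℝ = 0 := by
  rw [← inner_refl_left] at hγq
  have hreflγy : ⟪refl β γ, y⟫_ℝ = 0 :=
    mem_minimalFlat_iff.1 hy _ (map_mem_roots hβ.2 hγ) hγq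
  have hβγ : ⟪β, γ⟫_ℝ = 0 := by
    rw [refl_apply_of_norm_eq_one hβ.1, inner_sub_left, real_inner_smul_left, hγy] at hreflγy
    simpa [hβy] using hreflγy
  exact ⟨hβγ, by rwa [refl_apply_eq_self_iff.2 hβγ] at hγq⟩

theorem exists_isGeneral_apply (hG : IsReflectionGroup G) (hess : IsEssential G)
    (hirr : IsIrreducible G) (hWG : W ≤ G)
    (hrank : rank W ≤ Module.finrank ℝ (minimalFlat G p)) : ∃ g ∈ G, IsGeneral W (g p) := by
  have : Finite G := hG.1
  let Z (g : O n) : Set (E n) := {γ | γ ∈ roots W ∧ ⟪γ, g p⟫_ℝ = 0}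
  obtain ⟨g, hg, hmin⟩ := (Set.toFinite (G : Set (O n))).exists_minimalFor Z _ ⟨1, G.one_mem⟩
  refine ⟨g, hg, isGeneral_iff.2 fun z hz hzg => ?_⟩
  have hrootsWG : roots W ⊆ roots G := fun α hα => ⟨hα.1, hWG hα.2⟩
  have hz0 : z ≠ 0 := ne_zero_of_mem_roots hz
  have hzF : z ∈ (minimalFlat G (g p))ᗮ := (Submodule.mem_orthogonal' _ _).2 fun v hv =>
    mem_minimalFlat_iff.1 hv z (hrootsWG hz) hzg
  obtain ⟨y, hyF, hyW, hy0⟩ := exists_mem_orthogonal_ne_zero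
    (hrank.trans (finrank_minimalFlat_le_map hg)) hz0 (Submodule.subset_span hz) hzF
  obtain ⟨β, hβ, hβy, hβz⟩ := hirr.exists_root_inner_ne_zero hG hess hy0 hz0
  have hnew : ∀ γ ∈ Z (refl β * g), ⟪β, γ⟫_ℝ = 0 ∧ ⟪γ, g p⟫_ℝ = 0 := fun γ ⟨hγ, hγβg⟩ =>
    inner_eq_zero_of_inner_refl_eq_zero hβ (hrootsWG hγ) hyF hβy
      (hyW γ (Submodule.subset_span hγ)) hγβg
  have hzβ : z ∈ Z (refl β * g) :=
    hmin (G.mul_mem hβ.2 hg) (fun γ hγ => ⟨hγ.1, (hnew γ hγ).2⟩) ⟨hz, hzg⟩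
  exact hβz (hnew z hzβ).1

end Flats

section Conjugation

variable {W : Subgroup (O n)} {p : E n}

theorem mem_conj_smul_iff {g h : O n} : h ∈ MulAut.conj g • W ↔ g⁻¹ * h * g ∈ W := by
  rw [Subgroup.mem_pointwise_smul_iff_inv_smul_mem, ← map_inv, MulAut.smul_def, MulAut.conj_apply,
    inv_inv]

theorem roots_conj_smul (g : O n) (W : Subgroup (O n)) :
    roots (MulAut.conj g • W) = g '' roots W := by
  have hiff : ∀ α, g α ∈ roots (MulAut.conj g • W) ↔ α ∈ roots W := fun α => by
    simp only [roots, Set.mem_ofPred_eq, g.norm_map, refl_map, mem_conj_smul_iff, mul_assoc,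
      inv_mul_cancel_left, inv_mul_cancel, mul_one]
  ext α
  obtain ⟨α, rfl⟩ := g.surjective α
  rw [hiff, g.injective.mem_set_image]

theorem conj_smul_reflClosure (g : O n) (S : Set (E n)) :
    MulAut.conj g • reflClosure S = reflClosure (g '' S) := by
  simp only [reflClosure, Subgroup.smul_closure, ← Set.image_smul, Set.image_image, MulAut.smul_def,
    MulAut.conj_apply, refl_map]

theorem IsReflectionGroup.conj_smul (hW : IsReflectionGroup W) (g : O n) :
    IsReflectionGroup (MulAut.conj g • W) := by
  obtain ⟨_, hgen⟩ := isReflectionGroup_iff.1 hW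
  refine isReflectionGroup_iff.2
    ⟨Finite.of_equiv W (Subgroup.equivSMul (MulAut.conj g) W).toEquiv, ?_⟩
  rw [roots_conj_smul, ← conj_smul_reflClosure, hgen]

theorem isGeneral_conj_smul_iff {g : O n} :
    IsGeneral (MulAut.conj g • W) (g p) ↔ IsGeneral W p := by
  simp only [isGeneral_iff, roots_conj_smul, Set.forall_mem_image, g.inner_map_map]

end Conjugation

section Invariants

open MvPolynomial

variable {W : Subgroup (O n)} {f : MvPolynomial (Fin n) ℝ}

/-- Substitution of the coordinates of `g x` for the variables, that is, `f ↦ f ∘ g`. -/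
noncomputable def precomp (g : O n) : MvPolynomial (Fin n) ℝ →ₐ[ℝ] MvPolynomial (Fin n) ℝ :=
  aeval ((g.toLinearEquiv : E n →ₗ[ℝ] E n).toMvPolynomial
    (EuclideanSpace.basisFun (Fin n) ℝ).toBasis (EuclideanSpace.basisFun (Fin n) ℝ).toBasis)

theorem eval_precomp (g : O n) (x : E n) (f : MvPolynomial (Fin n) ℝ) :
    eval (fun i => x i) (precomp g f) = eval (fun i => g x i) f := by
  have hcoord (i : Fin n) : eval (fun i => x i) (precomp g (X i)) = g x i := by
    rw [precomp, aeval_X]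
    exact (LinearMap.toMvPolynomial_eval_eq_apply _ _ _ i
      ((EuclideanSpace.basisFun (Fin n) ℝ).toBasis.repr x)).trans
      (by rw [LinearEquiv.symm_apply_apply]; rfl)
  induction f using MvPolynomial.induction_on with
  | C a => simp only [precomp, algHom_C, algebraMap_eq, eval_C]
  | add p q hp hq => simp only [map_add, hp, hq]
  | mul_X p i hp => simp only [map_mul, hp, hcoord, eval_X]

theorem precomp_precomp_inv (g : O n) (f : MvPolynomial (Fin n) ℝ) :
    precomp g (precomp g⁻¹ f) = f := by
  refine MvPolynomial.funext fun x => (eval_precomp g (WithLp.toLp 2 x) _).trans ?_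
  rw [eval_precomp]
  exact congrArg (fun y : E n => eval (fun i => y i) f) (g.symm_apply_apply _)

/-- The action of `g` on polynomials, `f ↦ f ∘ g⁻¹`. -/
noncomputable def translate (g : O n) :
    MvPolynomial (Fin n) ℝ ≃ₐ[ℝ] MvPolynomial (Fin n) ℝ :=
  AlgEquiv.ofAlgHom (precomp g⁻¹) (precomp g)
    (AlgHom.ext fun f => by simpa using precomp_precomp_inv g⁻¹ f)
    (AlgHom.ext (precomp_precomp_inv g))

theorem eval_translate (g : O n) (x : E n) (f : MvPolynomial (Fin n) ℝ) :
    eval (fun i => x i) (translate g f) = eval (fun i => g⁻¹ x i) f :=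
  eval_precomp g⁻¹ x f

theorem isHomogeneous_translate (g : O n) {m : ℕ} (hf : f.IsHomogeneous m) :
    (translate g f).IsHomogeneous m := by
  rw [← one_mul m]
  exact hf.aeval _ fun i => LinearMap.toMvPolynomial_isHomogeneous _ _ _ i

theorem totalDegree_translate (g : O n) (hf : f.IsHomogeneous f.totalDegree) :
    (translate g f).totalDegree = f.totalDegree := by
  rcases eq_or_ne f 0 with rfl | hne
  · rw [map_zero]
  · exact (isHomogeneous_translate g hf).totalDegree
      ((map_ne_zero_iff _ (translate g).injective).2 hne)

theorem translate_mem_invariants_iff (g : O n) :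
    translate g f ∈ invariants (MulAut.conj g • W) ↔ f ∈ invariants W := by
  constructor
  · intro hf h hh x
    have := hf (g * h * g⁻¹) (mem_conj_smul_iff.2 (by simpa [mul_assoc] using hh)) (g x)
    have hconj : g⁻¹ ((g * h * g⁻¹) (g x)) = h x :=
      (g.symm_apply_apply _).trans (congrArg h (g.symm_apply_apply x))
    have hcancel : g⁻¹ (g x) = x := g.symm_apply_apply x
    rwa [eval_translate, eval_translate, hconj, hcancel] at this
  · intro hf h hh x
    have hconj : (g⁻¹ * h * g) (g⁻¹ x) = g⁻¹ (h x) :=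
      congrArg (fun y => g⁻¹ (h y)) (g.apply_symm_apply x)
    rw [eval_translate, eval_translate, ← hconj]
    exact hf _ (mem_conj_smul_iff.1 hh) (g⁻¹ x)

theorem map_translate_invariants (g : O n) (W : Subgroup (O n)) :
    (invariants W).map (translate g : MvPolynomial (Fin n) ℝ →ₐ[ℝ] MvPolynomial (Fin n) ℝ) =
      invariants (MulAut.conj g • W) := by
  ext f
  obtain ⟨f, rfl⟩ := (translate g).surjective f
  rw [translate_mem_invariants_iff]
  exact (translate g).injective.mem_set_image

theorem IsBasicInvariants.conj_smul {π : Fin n → MvPolynomial (Fin n) ℝ}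
    (hπ : IsBasicInvariants W π) (g : O n) :
    IsBasicInvariants (MulAut.conj g • W) (translate g ∘ π) where
  homogeneous i := by
    rw [Function.comp_apply, totalDegree_translate g (hπ.homogeneous i)]
    exact isHomogeneous_translate g (hπ.homogeneous i)
  algebraicIndependent :=
    hπ.algebraicIndependent.map' (f := (translate g).toAlgHom) (translate g).injective
  generate := by
    rw [← map_translate_invariants, ← hπ.generate, AlgHom.map_adjoin, Set.range_comp]
    rfl

theorem topDegree_conj_smul (g : O n) (W : Subgroup (O n)) :
    topDegree (MulAut.conj g • W) = topDegree W := by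
  have degree_mem (g : O n) (W : Subgroup (O n)) {e : ℕ}
      (he : ∃ π : Fin n → MvPolynomial (Fin n) ℝ,
        IsBasicInvariants W π ∧ ∃ i, e = (π i).totalDegree) :
      ∃ π : Fin n → MvPolynomial (Fin n) ℝ,
        IsBasicInvariants (MulAut.conj g • W) π ∧ ∃ i, e = (π i).totalDegree := by
    obtain ⟨π, hπ, i, rfl⟩ := he
    exact ⟨_, hπ.conj_smul g, i, (totalDegree_translate g (hπ.homogeneous i)).symm⟩
  refine congrArg sSup (Set.ext fun e => ⟨fun he => ?_, degree_mem g W⟩)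
  have := degree_mem g⁻¹ _ he
  rwa [map_inv, inv_smul_smul] at this

end Invariants

theorem strataNumber_lt_rank {G W : Subgroup (O n)} {d : ℕ} (hG : IsReflectionGroup G)
    (hess : IsEssential G) (hirr : IsIrreducible G) (hWG : W ≤ G) (hW : IsReflectionGroup W)
    (hne : W ≠ ⊥) (hd : d < 2 * topDegree W) : strataNumber G d < rank W := by
  have hpos : 0 < rank W := hW.rank_pos hne
  suffices h : strataNumber G d ≤ rank W - 1 by lia
  refine Nat.sInf_le fun p hp => ?_
  have hrank : rank W ≤ Module.finrank ℝ (minimalFlat G p) :=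
    Nat.le_of_pred_lt (lt_finrank_minimalFlat ((Nat.pred_le _).trans rank_le) hp)
  obtain ⟨g, hg, hgen⟩ := exists_isGeneral_apply hG hess hirr hWG hrank
  refine ⟨MulAut.conj g⁻¹ • W, Subgroup.conj_smul_le_of_le hWG ⟨g⁻¹, inv_mem hg⟩,
    hW.conj_smul g⁻¹, ?_, by rwa [topDegree_conj_smul]⟩
  have := isGeneral_conj_smul_iff (g := g⁻¹).2 hgen
  rwa [show g⁻¹ (g p) = p from g.symm_apply_apply p] at this

end ReflGrp

theorem corollary5p3_general (n : ℕ)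
    (G : Subgroup (ReflGrp.O n)) (hG : ReflGrp.IsReflectionGroup G)
    (hess : ReflGrp.IsEssential G) (hirr : ReflGrp.IsIrreducible G)
    (Δ : Finset (ReflGrp.E n)) (hΔ : ∀ α ∈ Δ, α ∈ ReflGrp.roots G) (d : ℕ) :
    (ReflGrp.strataNumber G d : ℕ∞) ≤ ReflGrp.parabolicNumber Δ d := by
  refine le_sInf ?_
  rintro _ ⟨I, hIΔ, hI, hd, rfl⟩
  have := hG.1
  have hroots : (I : Set (ReflGrp.E n)) ⊆ ReflGrp.roots G := fun α hα => hΔ α (hIΔ hα)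
  have hcard : ReflGrp.rank (ReflGrp.parabolic I) ≤ I.card := ReflGrp.rank_parabolic_le_card I
  have hlt : ReflGrp.strataNumber G d < ReflGrp.rank (ReflGrp.parabolic I) := by
    rw [ReflGrp.parabolic_eq_reflClosure] at hd ⊢
    exact ReflGrp.strataNumber_lt_rank hG hess hirr (ReflGrp.reflClosure_le hroots)
      (ReflGrp.isReflectionGroup_reflClosure hroots) (ReflGrp.reflClosure_ne_bot hroots hI) hd
  exact_mod_cast (by lia : ReflGrp.strataNumber G d ≤ I.card - 1)

theorem corollary5p3 (n : ℕ) (hn : 1 ≤ n)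
    (G : Subgroup (ReflGrp.O n)) (hG : ReflGrp.IsReflectionGroup G)
    (hess : ReflGrp.IsEssential G) (hirr : ReflGrp.IsIrreducible G)
    (Δ : Finset (ReflGrp.E n)) (hΔ : ReflGrp.IsSimpleSystem G Δ) (d : ℕ) :
    (ReflGrp.strataNumber G d : ℕ∞) ≤ ReflGrp.parabolicNumber Δ d :=
  corollary5p3_general n G hG hess hirr Δ hΔ.subset_roots d
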